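/- Let $W_0$, $W_1$ be finite-dimensional real vector spaces, $\langle\cdot,\cdot\rangle$ a nondegenerate symmetric bilinear form on $W_1$, and $\partial : W_1 \to W_0$ a linear map such that the image of $\partial^* : W_0^* \to W_1^* \cong W_1$ is isotropic (equivalently, $W_0^* \xrightarrow{\partial^*} W_1 \xrightarrow{\partial} W_0$ is a chain complex). Let $(V_\bullet,\omega)$ be the corresponding symmetric constant symplectic $2$-groupoid. Here $V_\bullet$ is the simplicial vector space associated with this chain complex, with $$V_0 = W_0,\qquad V_1 = W_1\oplus W_0,\qquad V_2 = W_0^*\oplus W_1\oplus W_1\oplus W_0,$$ face maps $f_0(w_1,w_0)=w_0$, $f_1(w_1,w_0)=w_0-\partial w_1$ on $V_1$, $f_0(w_2,w_1,w_1',w_0)=(w_1,w_0)$, $f_1(w_2,w_1,w_1',w_0)=(w_1',w_0)$, $f_2(w_2,w_1,w_1',w_0)=(\partial^*w_2+w_1'-w_1,\,w_0-\partial w_1)$ on $V_2$, degeneracy maps $\sigma_0(w_0)=(0,w_0)$, $\sigma_0(w_1,w_0)=(0,w_1,w_1,w_0)$, $\sigma_1(w_1,w_0)=(0,0,w_1,w_0)$,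 and higher simplices determined by unique horn filling; and $\omega$ is the constant, normalized, multiplicative $2$-form on $V_2$ whose component pairing $W_0$ with $W_0^*$ is the canonical one and whose component $C_{32}(w,w')=\omega((0,0,w,0),(0,w',0,0))$ on $W_1$ is $\tfrac12\langle\cdot,\cdot\rangle$. Let $E = W_1\times W_0\to W_0$ be the corresponding constant Courant algebroid: its pairing is $\langle\cdot,\cdot\rangle$, its anchor is $\rho(w_1,w_0)=(\partial w_1,w_0)$, and its bracket is $$[\![ f w, g w' ]\!] = f\rho(w)(g)\,w' - g\rho(w')(f)\,w + g\langle w,w'\rangle\,\mathcal D f,\qquad f,g\in C^\infty(W_0),\ w,w'\in W_1,$$ where $\langle \mathcal D f,e\rangle=\rho(e)(f)$. A constant Dirac structure is a subbundle of $E$ of the form $U_1\times W_0$, with $U_1\subseteq W_1$ a subspace, that equals its own orthogonal and whose sections are closed under the bracket. A linear sub-$2$-groupoid $L_\bullet\subseteq V_\bullet$ is a simplicial subspace that is itself a $2$-groupoid (its $(q,k)$-horn maps are surjective for $q\ge1$ and bijective for $q>2$); it is Lagrangian if $L_2$ equals its $\omega$-orthogonal in $V_2$, and wide if $L_0=V_0$.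 Then there is a one-to-one correspondence between constant Dirac structures $U_1\times W_0\subseteq W_1\times W_0$ and wide linear Lagrangian sub-$2$-groupoids $L_\bullet\subseteq V_\bullet$, under which $U_1\times W_0$ corresponds to the $L_\bullet$ with $L_1 = U_1\oplus W_0$ and $L_2 = 0\oplus U_1\oplus U_1\oplus W_0$. -/

import Mathlib

open CategoryTheory Opposite Simplicial

set_option linter.unusedSectionVars false

universe u v

noncomputable section

/-! ### Linear 2-groupoids -/

/-- A simplicial real vector space. -/
abbrev SimplicialVect := SimplicialObject (ModuleCat.{u} ℝ)

namespace SimplicialVect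

variable (V : SimplicialVect.{u})

/-- The face map `f_i : V_{n+1} → V_n`. -/
abbrev face {n : ℕ} (i : Fin (n + 2)) : V _⦋n + 1⦌ →ₗ[ℝ] V _⦋n⦌ := (V.δ i).hom

/-- The degeneracy map `σ_i : V_n → V_{n+1}`. -/
abbrev degen {n : ℕ} (i : Fin (n + 1)) : V _⦋n⦌ →ₗ[ℝ] V _⦋n + 1⦌ := (V.σ i).hom

/-- The horn compatibility equations `f_i x_j = f_{j-1} x_i`, `i < j`, for a `(q+1, k)`-horn
`(x_i)_{i ≠ k}` of `q`-simplices. A pair of indices `i < j` is written here as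
`i.castSucc < j.succ` with `i ≤ j`. There is no condition on `(1, k)`-horns. -/
def IsHorn (q : ℕ) (k : Fin (q + 2)) (x : {i : Fin (q + 2) // i ≠ k} → V _⦋q⦌) : Prop :=
  match q, k, x with
  | 0, _, _ => True
  | q + 1, k, x => ∀ (i j : Fin (q + 2)) (hi : i.castSucc ≠ k) (hj : j.succ ≠ k), i ≤ j →
      V.face i (x ⟨j.succ, hj⟩) = V.face j (x ⟨i.castSucc, hi⟩)

/-- A linear 2-groupoid: a simplicial finite-dimensional vector space all of whose horn maps are
surjective, and whose `(m, k)`-horn maps are bijective for `m > 2`. (A linear map between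
finite-dimensional spaces is a surjective submersion iff it is surjective, and a diffeomorphism iff
it is bijective.) -/
structure IsTwoGroupoid : Prop where
  finite : ∀ n, Module.Finite ℝ (V _⦋n⦌)
  fill : ∀ (q : ℕ) (k : Fin (q + 2)) (x : {i : Fin (q + 2) // i ≠ k} → V _⦋q⦌),
    V.IsHorn q k x → ∃ y : V _⦋q + 1⦌, ∀ i, V.face i.1 y = x i
  unique : ∀ (q : ℕ) (k : Fin (q + 2)) (y y' : V _⦋q + 1⦌), 2 < q + 1 →
    (∀ i, i ≠ k → V.face i y = V.face i y') → y = y'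

variable {V}

theorem face_face {n : ℕ} {i j : Fin (n + 2)} (h : i ≤ j) (x : V _⦋n + 2⦌) :
    V.face i (V.face j.succ x) = V.face j (V.face i.castSucc x) := by
  have := congrArg (fun f => f.hom x) (V.δ_comp_δ h)
  simpa using this

theorem face_degen_castSucc {n : ℕ} (i : Fin (n + 1)) (x : V _⦋n⦌) :
    V.face i.castSucc (V.degen i x) = x := by
  have := congrArg (fun f => f.hom x) (V.δ_comp_σ_self (i := i))
  simpa using this

theorem face_degen_succ {n : ℕ} (i : Fin (n + 1)) (x : V _⦋n⦌) :
    V.face i.succ (V.degen i x) = x := by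
  have := congrArg (fun f => f.hom x) (V.δ_comp_σ_succ (i := i))
  simpa using this

theorem face_degen_of_le {n : ℕ} {i : Fin (n + 2)} {j : Fin (n + 1)} (h : i ≤ j.castSucc)
    (x : V _⦋n + 1⦌) : V.face i.castSucc (V.degen j.succ x) = V.degen j (V.face i x) := by
  have := congrArg (fun f => f.hom x) (V.δ_comp_σ_of_le h)
  simpa using this

theorem face_degen_of_gt {n : ℕ} {i : Fin (n + 2)} {j : Fin (n + 1)} (h : j.castSucc < i)
    (x : V _⦋n + 1⦌) : V.face i.succ (V.degen j.castSucc x) = V.degen j (V.face i x) := by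
  have := congrArg (fun f => f.hom x) (V.δ_comp_σ_of_gt h)
  simpa using this

theorem exists_filler_low {q : ℕ} {k : Fin (q + 3)} {x : {i : Fin (q + 3) // i ≠ k} → V _⦋q + 1⦌}
    (hx : V.IsHorn (q + 1) k x) (r : ℕ) (hr : r ≤ k.1) :
    ∃ y : V _⦋q + 2⦌, ∀ i (hi : i ≠ k), i.1 < r → V.face i y = x ⟨i, hi⟩ := by
  induction r with
  | zero => exact ⟨0, fun i _ h => absurd h (by omega)⟩
  | succ r ih =>
    obtain ⟨y, hy⟩ := ih (by omega)
    obtain ⟨s, hs⟩ : ∃ s : Fin (q + 2), s.1 = r := ⟨⟨r, by omega⟩, rfl⟩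
    have hsk : s.castSucc ≠ k := by
      intro h; have := congrArg Fin.val h; simp at this; omega
    refine ⟨y + V.degen s (x ⟨s.castSucc, hsk⟩ - V.face s.castSucc y), ?_⟩
    intro i hi hir
    rw [map_add]
    rcases Nat.lt_succ_iff_lt_or_eq.mp hir with h | h
    · obtain ⟨t, rfl⟩ : ∃ t : Fin (q + 1), s = t.succ :=
        ⟨⟨r - 1, by omega⟩, by ext; simp; omega⟩
      obtain ⟨i, rfl⟩ : ∃ j : Fin (q + 2), i = j.castSucc :=
        ⟨⟨i.1, by omega⟩, by ext; simp⟩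
      have hit : i ≤ t.castSucc := by
        simp at hs h
        rw [Fin.le_def]; simp; omega
      have h1 := hx i t.castSucc hi hsk hit
      have h2 := face_face hit y
      rw [hy _ hi h] at h2 ⊢
      rw [face_degen_of_le hit, map_sub]
      erw [h1, h2]
      simp
    · obtain rfl : i = s.castSucc := by ext; simp [hs, h]
      rw [face_degen_castSucc]; abel

theorem exists_filler_high {q : ℕ} {k : Fin (q + 3)}
    {x : {i : Fin (q + 3) // i ≠ k} → V _⦋q + 1⦌}
    (hx : V.IsHorn (q + 1) k x) (r : ℕ) (hr : r + k.1 ≤ q + 2) :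
    ∃ y : V _⦋q + 2⦌, ∀ i (hi : i ≠ k), (i.1 < k.1 ∨ q + 2 < i.1 + r) →
      V.face i y = x ⟨i, hi⟩ := by
  induction r with
  | zero =>
    obtain ⟨y, hy⟩ := exists_filler_low hx k.1 le_rfl
    exact ⟨y, fun i hi h => hy i hi (by omega)⟩
  | succ r ih =>
    obtain ⟨y, hy⟩ := ih (by omega)
    obtain ⟨s, hs⟩ : ∃ s : Fin (q + 2), s.1 + r = q + 1 := ⟨⟨q + 1 - r, by omega⟩, by simp; omega⟩
    have hsk : s.succ ≠ k := by
      intro h; have := congrArg Fin.val h; simp at this; omega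
    refine ⟨y + V.degen s (x ⟨s.succ, hsk⟩ - V.face s.succ y), ?_⟩
    intro i hi hir
    rw [map_add]
    by_cases his : i = s.succ
    · subst his
      rw [face_degen_succ]; abel
    have hne : i.1 ≠ s.1 + 1 := fun h' => his (by ext; simpa using h')
    rcases hir with h | h
    · obtain ⟨t, rfl⟩ : ∃ t : Fin (q + 1), s = t.succ :=
        ⟨⟨s.1 - 1, by omega⟩, by ext; simp; omega⟩
      obtain ⟨i, rfl⟩ : ∃ j : Fin (q + 2), i = j.castSucc :=
        ⟨⟨i.1, by omega⟩, by ext; simp⟩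
      have hit : i ≤ t.castSucc := by
        simp at hs h
        rw [Fin.le_def]; simp; omega
      have hit' : i ≤ t.succ := hit.trans (Fin.castSucc_lt_succ).le
      have h1 := hx i t.succ hi hsk hit'
      have h2 := face_face hit' y
      rw [hy _ hi (Or.inl h)] at h2 ⊢
      rw [face_degen_of_le hit, map_sub]
      erw [h1, h2]
      simp
    · obtain ⟨t, rfl⟩ : ∃ t : Fin (q + 1), s = t.castSucc :=
        ⟨⟨s.1, by omega⟩, by ext; simp⟩
      obtain ⟨i, rfl⟩ : ∃ j : Fin (q + 2), i = j.succ :=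
        ⟨⟨i.1 - 1, by omega⟩, by ext; simp; omega⟩
      have hlt : t.castSucc < i := by
        simp at hs h hne his
        rw [Fin.lt_def]; simp; omega
      have hit' : t.succ ≤ i := hlt
      have h1 := hx t.succ i hsk hi hit'
      have h2 := face_face hit' y
      have h3 : q + 2 < i.succ.1 + r := by
        simp at hs h hne ⊢; omega
      rw [hy _ hi (Or.inr h3)] at h2 ⊢
      rw [face_degen_of_gt hlt, map_sub]
      erw [← h1, ← h2]
      simp

/-- Every horn in a simplicial vector space has a filler. -/
theorem exists_filler (q : ℕ) (k : Fin (q + 2)) (x : {i : Fin (q + 2) // i ≠ k} → V _⦋q⦌)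
    (hx : V.IsHorn q k x) : ∃ y : V _⦋q + 1⦌, ∀ i, V.face i.1 y = x i := by
  rcases q with _ | q
  · by_cases hk : k = 0
    · subst hk
      refine ⟨V.degen 0 (x ⟨1, by simp⟩), ?_⟩
      rintro ⟨i, hi⟩
      obtain rfl : i = 1 := by revert hi; revert i; decide
      exact face_degen_succ 0 _
    · obtain rfl : k = 1 := (by decide : ∀ k : Fin 2, ¬k = 0 → k = 1) k hk
      refine ⟨V.degen 0 (x ⟨0, by simp⟩), ?_⟩
      rintro ⟨i, hi⟩
      obtain rfl : i = 0 := by revert hi; revert i; decide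
      exact face_degen_castSucc 0 _
  · obtain ⟨y, hy⟩ := exists_filler_high hx (q + 2 - k.1) (by omega)
    refine ⟨y, fun i => hy i.1 i.2 ?_⟩
    have : i.1.1 ≠ k.1 := fun h => i.2 (Fin.ext h)
    omega

/-! ### Constant symplectic 2-groupoids -/

/-- A constant 2-form on `V_2` (an alternating bilinear form) is normalized if its pullbacks along
the degeneracy maps vanish. -/
def IsNormalized (ω : LinearMap.BilinForm ℝ (V _⦋2⦌)) : Prop :=
  ∀ (i : Fin 2) (u v : V _⦋1⦌), ω (V.degen i u) (V.degen i v) = 0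

/-- A constant 2-form on `V_2` is multiplicative if its simplicial coboundary vanishes. -/
def IsMultiplicative (ω : LinearMap.BilinForm ℝ (V _⦋2⦌)) : Prop :=
  ∀ u v : V _⦋3⦌, ∑ i : Fin 4, (-1 : ℝ) ^ (i : ℕ) * ω (V.face i u) (V.face i v) = 0

/-- The pairing of `V_0` with `V_2` induced by `ω`; it descends to the quotient of `V_2` by the
degenerate subspace when `ω` is normalized. -/
def pairingA (ω : LinearMap.BilinForm ℝ (V _⦋2⦌)) (v : V _⦋0⦌) (w : V _⦋2⦌) : ℝ :=
  ω (V.degen 0 (V.degen 0 v)) w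

/-- The symmetric form on `V_1` induced by `ω`; it descends to the quotient of `V_1` by the
degenerate subspace when `ω` is normalized. -/
def pairingB (ω : LinearMap.BilinForm ℝ (V _⦋2⦌)) (θ η : V _⦋1⦌) : ℝ :=
  ω (V.degen 1 θ) (V.degen 0 η) + ω (V.degen 1 η) (V.degen 0 θ)

/-- Simplicial nondegeneracy: the pairings induced on the normalized quotients
`V_0`, `V_1 / σ_0 V_0`, `V_2 / (σ_0 V_1 + σ_1 V_1)` are nondegenerate. -/
structure IsSimpliciallyNondegenerate (ω : LinearMap.BilinForm ℝ (V _⦋2⦌)) : Prop where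
  left : ∀ v, (∀ w, pairingA ω v w = 0) → v = 0
  right : ∀ w, (∀ v, pairingA ω v w = 0) →
    w ∈ LinearMap.range (V.degen (0 : Fin 2)) ⊔ LinearMap.range (V.degen (1 : Fin 2))
  mid : ∀ θ, (∀ η, pairingB ω θ η = 0) → θ ∈ LinearMap.range (V.degen (0 : Fin 1))

end SimplicialVect

/-- A constant symplectic 2-groupoid: a linear 2-groupoid `V` with a constant 2-form on `V_2` that
is multiplicative, normalized and simplicially nondegenerate (a constant form is closed). -/
structure ConstantSymplecticTwoGroupoid where
  V : SimplicialVect.{u}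
  isTwoGroupoid : V.IsTwoGroupoid
  ω : LinearMap.BilinForm ℝ (V _⦋2⦌)
  alt : ω.IsAlt
  multiplicative : SimplicialVect.IsMultiplicative ω
  normalized : SimplicialVect.IsNormalized ω
  nondegenerate : SimplicialVect.IsSimpliciallyNondegenerate ω

/-- The component `C_32 (w, w') = ω ((0,0,w,0), (0,w',0,0))` of `ω` on `ker f_0 ⊆ V_1` is symmetric.
Here `(0,0,w,0) = σ_1 w` and `(0,w',0,0) = σ_0 w' - σ_1 w'`. -/
def ConstantSymplecticTwoGroupoid.IsSymmetric (S : ConstantSymplecticTwoGroupoid.{u}) : Prop :=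
  ∀ w w' : S.V _⦋1⦌, S.V.face 0 w = 0 → S.V.face 0 w' = 0 →
    S.ω (S.V.degen 1 w) (S.V.degen 0 w' - S.V.degen 1 w') =
      S.ω (S.V.degen 1 w') (S.V.degen 0 w - S.V.degen 1 w)

/-! ### Linear sub-2-groupoids -/

/-- A simplicial subspace of a simplicial vector space. -/
@[ext]
structure SimplicialSubspace (V : SimplicialVect.{u}) where
  obj : ∀ n : ℕ, Submodule ℝ (V _⦋n⦌)
  map_mem : ∀ {m n : ℕ} (θ : ⦋m⦌ ⟶ ⦋n⦌) (x : V _⦋n⦌), x ∈ obj n → (V.map θ.op).hom x ∈ obj m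

namespace SimplicialSubspace

variable {V : SimplicialVect.{u}} (L : SimplicialSubspace V)

/-- A simplicial subspace, as a simplicial vector space. -/
def toSimplicialVect : SimplicialVect.{u} where
  obj n := ModuleCat.of ℝ (L.obj n.unop.len)
  map θ := ModuleCat.ofHom ((V.map θ).hom.restrict fun x hx => L.map_mem θ.unop x hx)
  map_id n := by
    ext x
    simp [LinearMap.restrict_apply]
  map_comp f g := by
    ext x
    simp [LinearMap.restrict_apply]

/-- `L` is a linear sub-2-groupoid: a simplicial subspace that is itself a 2-groupoid. -/
def IsSubTwoGroupoid : Prop := L.toSimplicialVect.IsTwoGroupoid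

/-- `L` is wide: `L_0 = V_0`. -/
def IsWide : Prop := L.obj 0 = ⊤

/-- `L` is Lagrangian with respect to `ω`: `L_2` equals its `ω`-orthogonal in `V_2`. -/
def IsLagrangian (ω : LinearMap.BilinForm ℝ (V _⦋2⦌)) : Prop :=
  ∀ x, x ∈ L.obj 2 ↔ ∀ y ∈ L.obj 2, ω x y = 0

end SimplicialSubspace

/-! ### The linear 2-groupoid of a 3-term complex -/

section ThreeTerm

variable {W₀ : Type u} {W₁ : Type v} {W₂ : Type u}
  [AddCommGroup W₀] [Module ℝ W₀] [AddCommGroup W₁] [Module ℝ W₁] [AddCommGroup W₂] [Module ℝ W₂]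
  (d₁ : W₁ →ₗ[ℝ] W₀) (d₂ : W₂ →ₗ[ℝ] W₁)

/-- The space of `n`-simplices of the linear 2-groupoid of the complex `W₂ → W₁ → W₀`. An
`n`-simplex assigns an element `a i` of `W₀` to each vertex, `b i j` of `W₁` to each edge and
`c i j k` of `W₂` to each triangle of the standard `n`-simplex, vanishing on degenerate edges and
triangles (and, to fix the values, on tuples that are not increasing), such that
`∂ b_{ij} = a_j - a_i`, `∂ c_{ijk} = b_{jk} - b_{ik} + b_{ij}` and
`0 = c_{jkl} - c_{ikl} + c_{ijl} - c_{ijk}`. -/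
def simplices (n : ℕ) : Submodule ℝ ((Fin (n + 1) → W₀) × (Fin (n + 1) → Fin (n + 1) → W₁) ×
    (Fin (n + 1) → Fin (n + 1) → Fin (n + 1) → W₂)) where
  carrier := {x |
    (∀ i j, ¬ i < j → x.2.1 i j = 0) ∧
    (∀ i j k, ¬ (i < j ∧ j < k) → x.2.2 i j k = 0) ∧
    (∀ i j, i ≤ j → d₁ (x.2.1 i j) = x.1 j - x.1 i) ∧
    (∀ i j k, i ≤ j → j ≤ k → d₂ (x.2.2 i j k) = x.2.1 j k - x.2.1 i k + x.2.1 i j) ∧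
    (∀ i j k l, i ≤ j → j ≤ k → k ≤ l →
      x.2.2 j k l - x.2.2 i k l + x.2.2 i j l - x.2.2 i j k = 0)}
  zero_mem' := by simp
  add_mem' := by
    rintro x y ⟨h1, h2, h3, h4, h5⟩ ⟨g1, g2, g3, g4, g5⟩
    refine ⟨fun i j h => by simp [h1 i j h, g1 i j h], fun i j k h => by simp [h2 i j k h, g2 i j k h],
      fun i j h => ?_, fun i j k h h' => ?_, fun i j k l h h' h'' => ?_⟩
    · simp only [Prod.fst_add, Prod.snd_add, Pi.add_apply, map_add, h3 i j h, g3 i j h]; abel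
    · simp only [Prod.fst_add, Prod.snd_add, Pi.add_apply, map_add, h4 i j k h h', g4 i j k h h']
      abel
    · have e1 := h5 i j k l h h' h''
      have e2 := g5 i j k l h h' h''
      simp only [Prod.snd_add, Pi.add_apply]
      rw [← add_zero (0 : W₂)]
      nth_rewrite 1 [← e1]
      rw [← e2]; abel
  smul_mem' := by
    rintro r x ⟨h1, h2, h3, h4, h5⟩
    refine ⟨fun i j h => by simp [h1 i j h], fun i j k h => by simp [h2 i j k h],
      fun i j h => ?_, fun i j k h h' => ?_, fun i j k l h h' h'' => ?_⟩
    · simp only [Prod.smul_fst, Prod.smul_snd, Pi.smul_apply, map_smul, h3 i j h, smul_sub]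
    · simp only [Prod.smul_fst, Prod.smul_snd, Pi.smul_apply, map_smul, h4 i j k h h', smul_sub,
        smul_add]
    · simp only [Prod.smul_snd, Pi.smul_apply, ← smul_sub, ← smul_add, h5 i j k l h h' h'',
        smul_zero]

/-- The action of a monotone map `θ : {0,…,m} → {0,…,n}` on simplices, by precomposition. -/
def simplicesMap {m n : ℕ} (θ : Fin (m + 1) →o Fin (n + 1)) :
    simplices d₁ d₂ n →ₗ[ℝ] simplices d₁ d₂ m where
  toFun x := ⟨(fun i => x.1.1 (θ i), fun i j => x.1.2.1 (θ i) (θ j),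
      fun i j k => x.1.2.2 (θ i) (θ j) (θ k)), by
    obtain ⟨x, h1, h2, h3, h4, h5⟩ := x
    exact ⟨fun i j h => h1 _ _ fun h' => h (θ.monotone.reflect_lt h'),
      fun i j k h => h2 _ _ _ fun h' =>
        h ⟨θ.monotone.reflect_lt h'.1, θ.monotone.reflect_lt h'.2⟩,
      fun i j h => h3 _ _ (θ.monotone h),
      fun i j k h h' => h4 _ _ _ (θ.monotone h) (θ.monotone h'),
      fun i j k l h h' h'' => h5 _ _ _ _ (θ.monotone h) (θ.monotone h') (θ.monotone h'')⟩⟩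
  map_add' _ _ := rfl
  map_smul' _ _ := rfl

/-- The linear 2-groupoid of the 3-term complex `W₂ → W₁ → W₀`. -/
def complexSimplicialVect : SimplicialVect.{max u v} where
  obj n := ModuleCat.of ℝ (simplices d₁ d₂ n.unop.len)
  map θ := ModuleCat.ofHom (simplicesMap d₁ d₂ θ.unop.toOrderHom)
  map_id _ := rfl
  map_comp _ _ := rfl

variable {d₁ d₂}

/-- The identification `V_0 = W₀`. -/
def vertexEquiv : simplices d₁ d₂ 0 ≃ₗ[ℝ] W₀ where
  toFun x := x.1.1 0
  map_add' _ _ := rfl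
  map_smul' _ _ := rfl
  invFun w := ⟨(fun _ => w, fun _ _ => 0, fun _ _ _ => 0), by simp [simplices]⟩
  left_inv := by
    rintro ⟨⟨a, b, c⟩, h1, h2, h3, h4, h5⟩
    refine Subtype.ext (Prod.ext ?_ (Prod.ext ?_ ?_))
    · funext i; exact congrArg a (Subsingleton.elim (α := Fin 1) 0 i)
    · funext i j; exact (h1 i j fun h => h.ne (Subsingleton.elim (α := Fin 1) i j)).symm
    · funext i j k; exact (h2 i j k fun h => h.1.ne (Subsingleton.elim (α := Fin 1) i j)).symm
  right_inv _ := rfl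

/-- The identification `V_1 = W₁ ⊕ W₀`: an edge is determined by its `W₁`-label and its last
vertex `f_0`. -/
def edgeEquiv : simplices d₁ d₂ 1 ≃ₗ[ℝ] W₁ × W₀ where
  toFun x := (x.1.2.1 0 1, x.1.1 1)
  map_add' _ _ := rfl
  map_smul' _ _ := rfl
  invFun w := ⟨(![w.2 - d₁ w.1, w.2], ![![0, w.1], ![0, 0]], fun _ _ _ => 0), by
    refine ⟨?_, ?_, ?_, ?_, ?_⟩
    · simp [Fin.forall_fin_two]
    · simp
    · simp [Fin.forall_fin_two]
    · simp [Fin.forall_fin_two]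
    · simp⟩
  left_inv := by
    rintro ⟨⟨a, b, c⟩, h1, h2, h3, h4, h5⟩
    refine Subtype.ext (Prod.ext ?_ (Prod.ext ?_ ?_))
    · funext i
      have := h3 0 1 (by decide)
      fin_cases i <;> simp_all
    · funext i j
      fin_cases i <;> fin_cases j <;> first | rfl | exact (h1 _ _ (by decide)).symm
    · funext i j k
      exact (h2 i j k (by revert i j k; decide)).symm
  right_inv _ := rfl

/-- The identification `V_2 = W₂ ⊕ W₁ ⊕ W₁ ⊕ W₀`: a triangle is determined by its `W₂`-label, the
`W₁`-labels of its faces `f_0` and `f_1`, and its last vertex. -/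
def triangleEquiv (hd : d₁ ∘ₗ d₂ = 0) :
    simplices d₁ d₂ 2 ≃ₗ[ℝ] W₂ × W₁ × W₁ × W₀ where
  toFun x := (x.1.2.2 0 1 2, x.1.2.1 1 2, x.1.2.1 0 2, x.1.1 2)
  map_add' _ _ := rfl
  map_smul' _ _ := rfl
  invFun w := ⟨(![w.2.2.2 - d₁ w.2.2.1, w.2.2.2 - d₁ w.2.1, w.2.2.2],
      ![![0, d₂ w.1 + w.2.2.1 - w.2.1, w.2.2.1], ![0, 0, w.2.1], ![0, 0, 0]],
      fun i j k => if i < j ∧ j < k then w.1 else 0), by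
    refine ⟨?_, ?_, ?_, ?_, ?_⟩
    · intro i j h
      fin_cases i <;> fin_cases j <;> first | rfl | exact absurd (by decide) h
    · intro i j k h
      exact if_neg h
    · have hd' : d₁ (d₂ w.1) = 0 := LinearMap.congr_fun hd w.1
      intro i j h
      fin_cases i <;> fin_cases j <;> first | (exact absurd h (by decide)) | simp [hd']
    · intro i j k h h'
      rcases h.eq_or_lt with rfl | h1
      · fin_cases i <;> fin_cases k <;> first | (exact absurd h' (by decide)) | simp
      rcases h'.eq_or_lt with rfl | h2
      · fin_cases i <;> fin_cases j <;> first | (exact absurd h1 (by decide)) | simp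
      obtain ⟨rfl, rfl, rfl⟩ : i = 0 ∧ j = 1 ∧ k = 2 := by
        clear h h'; revert i j k; decide
      simp
    · intro i j k l h h' h''
      have : i = j ∨ j = k ∨ k = l := by revert i j k l; decide
      rcases this with rfl | rfl | rfl <;> simp⟩
  left_inv := by
    rintro ⟨⟨a, b, c⟩, h1, h2, h3, h4, h5⟩
    refine Subtype.ext (Prod.ext ?_ (Prod.ext ?_ ?_))
    · funext i
      have e1 := h3 0 2 (by decide)
      have e2 := h3 1 2 (by decide)
      fin_cases i <;> simp_all
    · funext i j
      have e1 := h4 0 1 2 (by decide) (by decide)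
      fin_cases i <;> fin_cases j <;> first
        | rfl
        | exact (h1 _ _ (by decide)).symm
        | (change d₂ (c 0 1 2) + b 0 2 - b 1 2 = b 0 1
           rw [show d₂ (c 0 1 2) = _ from e1]
           change b 1 2 - b 0 2 + b 0 1 + b 0 2 - b 1 2 = b 0 1
           abel)
    · funext i j k
      by_cases h : i < j ∧ j < k
      · obtain ⟨rfl, rfl, rfl⟩ : i = 0 ∧ j = 1 ∧ k = 2 := by
          revert i j k; decide
        rfl
      · exact (if_neg h).trans (h2 i j k h).symm
  right_inv _ := rfl

theorem complexSimplicialVect_unique (q : ℕ) (k : Fin (q + 2))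
    (y y' : (complexSimplicialVect d₁ d₂) _⦋q + 1⦌) (hq : 2 < q + 1)
    (h : ∀ i, i ≠ k → (complexSimplicialVect d₁ d₂).face i y =
      (complexSimplicialVect d₁ d₂).face i y') : y = y' := by
  have avoid : ∀ a b c : Fin (q + 2), ∃ i, i ≠ a ∧ i ≠ b ∧ i ≠ c := by
    intro a b c
    by_contra! hc
    have : (Finset.univ : Finset (Fin (q + 2))) ⊆ {a, b, c} := by
      intro i _
      simp only [Finset.mem_insert, Finset.mem_singleton]
      by_contra! h'
      exact h'.2.2 (hc i h'.1 h'.2.1)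
    have := (Finset.card_le_card this).trans Finset.card_le_three
    simp at this
    omega
  have ha : ∀ i, i ≠ k → ∀ m, y.1.1 (Fin.succAbove i m) = y'.1.1 (Fin.succAbove i m) :=
    fun i hi m => congrArg (fun z : simplices d₁ d₂ q => z.1.1 m) (h i hi)
  have hb : ∀ i, i ≠ k → ∀ m n, y.1.2.1 (Fin.succAbove i m) (Fin.succAbove i n) =
      y'.1.2.1 (Fin.succAbove i m) (Fin.succAbove i n) :=
    fun i hi m n => congrArg (fun z : simplices d₁ d₂ q => z.1.2.1 m n) (h i hi)
  have hc : ∀ i, i ≠ k → ∀ m n p,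
      y.1.2.2 (Fin.succAbove i m) (Fin.succAbove i n) (Fin.succAbove i p) =
      y'.1.2.2 (Fin.succAbove i m) (Fin.succAbove i n) (Fin.succAbove i p) :=
    fun i hi m n p => congrArg (fun z : simplices d₁ d₂ q => z.1.2.2 m n p) (h i hi)
  have hc' : ∀ l m n : Fin (q + 2), (∃ i, i ≠ k ∧ i ≠ l ∧ i ≠ m ∧ i ≠ n) →
      y.1.2.2 l m n = y'.1.2.2 l m n := by
    rintro l m n ⟨i, hi, hl, hm, hn⟩
    obtain ⟨l, rfl⟩ := Fin.exists_succAbove_eq hl.symm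
    obtain ⟨m, rfl⟩ := Fin.exists_succAbove_eq hm.symm
    obtain ⟨n, rfl⟩ := Fin.exists_succAbove_eq hn.symm
    exact hc i hi l m n
  have hk1 : ∀ m n : Fin (q + 2), y.1.2.2 k m n = y'.1.2.2 k m n := fun m n => by
    obtain ⟨i, h1, h2, h3⟩ := avoid k m n
    exact hc' _ _ _ ⟨i, h1, h1, h2, h3⟩
  have hk2 : ∀ m n : Fin (q + 2), y.1.2.2 m k n = y'.1.2.2 m k n := fun m n => by
    obtain ⟨i, h1, h2, h3⟩ := avoid k m n
    exact hc' _ _ _ ⟨i, h1, h2, h1, h3⟩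
  have hk3 : ∀ m n : Fin (q + 2), y.1.2.2 m n k = y'.1.2.2 m n k := fun m n => by
    obtain ⟨i, h1, h2, h3⟩ := avoid k m n
    exact hc' _ _ _ ⟨i, h1, h2, h3, h1⟩
  refine Subtype.ext (Prod.ext ?_ (Prod.ext ?_ ?_))
  · funext m
    obtain ⟨i, hi, hm, -⟩ := avoid k m m
    obtain ⟨m, rfl⟩ := Fin.exists_succAbove_eq hm.symm
    exact ha i hi m
  · funext m n
    obtain ⟨i, hi, hm, hn⟩ := avoid k m n
    obtain ⟨m, rfl⟩ := Fin.exists_succAbove_eq hm.symm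
    obtain ⟨n, rfl⟩ := Fin.exists_succAbove_eq hn.symm
    exact hb i hi m n
  · funext (l : Fin (q + 2)) (m : Fin (q + 2)) (n : Fin (q + 2))
    by_cases hlt : l < m ∧ m < n
    · obtain ⟨h1, h2⟩ := hlt
      have c := y.2.2.2.2.2
      have c' := y'.2.2.2.2.2
      rcases le_total k l with g | g
      · have e := c k l m n g h1.le h2.le
        have e' := c' k l m n g h1.le h2.le
        rw [hk1, hk1, hk1] at e
        rw [← e'] at e
        simpa using e
      rcases le_total k m with g' | g'
      · have e := c l k m n g g' h2.le
        have e' := c' l k m n g g' h2.le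
        rw [hk1, hk2, hk2] at e
        rw [← e'] at e
        simpa using e
      rcases le_total k n with g'' | g''
      · have e := c l m k n h1.le g' g''
        have e' := c' l m k n h1.le g' g''
        rw [hk2, hk2, hk3] at e
        rw [← e'] at e
        simpa using e
      · have e := c l m n k h1.le h2.le g''
        have e' := c' l m n k h1.le h2.le g''
        rw [hk3, hk3, hk3] at e
        rw [← e'] at e
        simpa using e
    · exact (y.2.2.1 l m n hlt).trans (y'.2.2.1 l m n hlt).symm

theorem complexSimplicialVect_isTwoGroupoid [FiniteDimensional ℝ W₀] [FiniteDimensional ℝ W₁]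
    [FiniteDimensional ℝ W₂] : (complexSimplicialVect d₁ d₂).IsTwoGroupoid where
  finite n := inferInstanceAs (Module.Finite ℝ (simplices d₁ d₂ n))
  fill := SimplicialVect.exists_filler
  unique := complexSimplicialVect_unique

end ThreeTerm

/-! ### The data `(W₁, W₀, ⟨·,·⟩, ∂)` and the associated symmetric constant symplectic 2-groupoid -/

/-- The data `(W₁, W₀, ⟨·,·⟩, ∂)`: a nondegenerate symmetric bilinear form on `W₁` and a linear map
`∂ : W₁ → W₀` such that the image of `∂^*` in `W₁^* ≅ W₁` is isotropic. -/
structure CourantData (W₀ : Type u) (W₁ : Type v) [AddCommGroup W₀] [Module ℝ W₀]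
    [AddCommGroup W₁] [Module ℝ W₁] [FiniteDimensional ℝ W₁] where
  pairing : LinearMap.BilinForm ℝ W₁
  symm : pairing.IsSymm
  nondegenerate : pairing.Nondegenerate
  bdry : W₁ →ₗ[ℝ] W₀
  isotropic : ∀ ξ η : Module.Dual ℝ W₀,
    pairing ((pairing.toDual nondegenerate).symm (ξ ∘ₗ bdry))
      ((pairing.toDual nondegenerate).symm (η ∘ₗ bdry)) = 0

namespace CourantData

section Groupoid

variable {W₀ : Type u} {W₁ : Type v} [AddCommGroup W₀] [Module ℝ W₀]
  [AddCommGroup W₁] [Module ℝ W₁] [FiniteDimensional ℝ W₁] (D : CourantData W₀ W₁)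

/-- The map `∂^* : W₀^* → W₁^* ≅ W₁`. -/
def bdryStar : Module.Dual ℝ W₀ →ₗ[ℝ] W₁ :=
  (D.pairing.toDual D.nondegenerate).symm.toLinearMap ∘ₗ D.bdry.dualMap

theorem pairing_bdryStar (ξ : Module.Dual ℝ W₀) (w : W₁) :
    D.pairing (D.bdryStar ξ) w = ξ (D.bdry w) := by
  simp [bdryStar]

theorem pairing_bdryStar_right (ξ : Module.Dual ℝ W₀) (w : W₁) :
    D.pairing w (D.bdryStar ξ) = ξ (D.bdry w) := by
  rw [D.symm.eq, pairing_bdryStar]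

theorem bdry_bdryStar (ξ : Module.Dual ℝ W₀) : D.bdry (D.bdryStar ξ) = 0 := by
  rw [← Module.forall_dual_apply_eq_zero_iff ℝ]
  intro η
  rw [← pairing_bdryStar]
  exact D.isotropic η ξ

theorem bdry_comp_bdryStar : D.bdry ∘ₗ D.bdryStar = 0 :=
  LinearMap.ext D.bdry_bdryStar

/-- The linear 2-groupoid `V` of the complex `W₀^* → W₁ → W₀` given by `∂^*` and `∂`. -/
def V : SimplicialVect.{max u v} := complexSimplicialVect D.bdry D.bdryStar

/-- `V_0 = W₀`. -/
def coord₀ : D.V _⦋0⦌ ≃ₗ[ℝ] W₀ := vertexEquiv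

/-- `V_1 = W₁ ⊕ W₀`. -/
def coord₁ : D.V _⦋1⦌ ≃ₗ[ℝ] W₁ × W₀ := edgeEquiv

/-- `V_2 = W₀^* ⊕ W₁ ⊕ W₁ ⊕ W₀`. -/
def coord₂ : D.V _⦋2⦌ ≃ₗ[ℝ] Module.Dual ℝ W₀ × W₁ × W₁ × W₀ :=
  triangleEquiv D.bdry_comp_bdryStar

/-- The bilinear form `C_32 = ½ ⟨·,·⟩` on `W₁`. -/
def C₃₂ : LinearMap.BilinForm ℝ W₁ := (1 / 2 : ℝ) • D.pairing

/-- The constant 2-form on `W₀^* ⊕ W₁ ⊕ W₁ ⊕ W₀`, in block form. The blocks are determined by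
`C_32` and by the canonical pairing `C_41` of `W₀` with `W₀^*`, through
`C_12(w₂,w₁) = C_32(∂w₂,w₁)`, `C_13(w₂,w₁) = C_32(w₁,∂w₂)`, `C_11(w₂,w₂') = -C_32(∂w₂,∂w₂')`,
`C_22 = -C_23 - C_32` and `C_ij(w,w') = -C_ji(w',w)`; the other blocks vanish. -/
def blockForm : LinearMap.BilinForm ℝ (Module.Dual ℝ W₀ × W₁ × W₁ × W₀) :=
  LinearMap.mk₂ ℝ
    (fun x y =>
      let (w₂, w₁, w₁', w₀) := x
      let (u₂, u₁, u₁', u₀) := y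
      (-D.C₃₂ (D.bdryStar w₂) (D.bdryStar u₂) + D.C₃₂ (D.bdryStar w₂) u₁
          + D.C₃₂ u₁' (D.bdryStar w₂) - w₂ u₀)
        + (-D.C₃₂ (D.bdryStar u₂) w₁ + (D.C₃₂ u₁ w₁ - D.C₃₂ w₁ u₁) - D.C₃₂ u₁' w₁)
        + (-D.C₃₂ w₁' (D.bdryStar u₂) + D.C₃₂ w₁' u₁)
        + u₂ w₀)
    (by intros; simp; ring) (by intros; simp; ring) (by intros; simp; ring) (by intros; simp; ring)

/-- The constant 2-form on `V_2`. -/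
def form : LinearMap.BilinForm ℝ (D.V _⦋2⦌) :=
  D.blockForm.compl₁₂ D.coord₂.toLinearMap D.coord₂.toLinearMap

/-- A simplified formula for the 2-form. -/
theorem form_apply (x y : D.V _⦋2⦌) :
    D.form x y = (1 / 2 : ℝ) * ((D.coord₂ x).1 (D.bdry (D.coord₂ y).2.1)
        + (D.coord₂ x).1 (D.bdry (D.coord₂ y).2.2.1)
        - (D.coord₂ y).1 (D.bdry (D.coord₂ x).2.1) - (D.coord₂ y).1 (D.bdry (D.coord₂ x).2.2.1)
        - D.pairing (D.coord₂ x).2.1 (D.coord₂ y).2.2.1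
        + D.pairing (D.coord₂ x).2.2.1 (D.coord₂ y).2.1)
      - (D.coord₂ x).1 (D.coord₂ y).2.2.2 + (D.coord₂ y).1 (D.coord₂ x).2.2.2 := by
  have s := D.symm.eq (D.coord₂ x).2.1 (D.coord₂ y).2.2.1
  have s' := D.symm.eq (D.coord₂ x).2.1 (D.coord₂ y).2.1
  simp only [form, blockForm, C₃₂, LinearMap.compl₁₂_apply, LinearEquiv.coe_coe,
    LinearMap.mk₂_apply, LinearMap.smul_apply, pairing_bdryStar, pairing_bdryStar_right,
    bdry_bdryStar, smul_eq_mul, map_zero]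
  rw [s, s']
  ring

theorem form_alt : D.form.IsAlt := by
  intro x
  have s := D.symm.eq (D.coord₂ x).2.1 (D.coord₂ x).2.2.1
  rw [form_apply, s]
  ring

theorem coord₂_degen_zero (x : D.V _⦋1⦌) :
    D.coord₂ (D.V.degen 0 x) = (0, (D.coord₁ x).1, (D.coord₁ x).1, (D.coord₁ x).2) := by
  refine Prod.ext ?_ rfl
  exact x.2.2.1 _ _ _ (by decide)

theorem coord₂_degen_one (x : D.V _⦋1⦌) :
    D.coord₂ (D.V.degen 1 x) = (0, 0, (D.coord₁ x).1, (D.coord₁ x).2) := by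
  refine Prod.ext ?_ (Prod.ext ?_ rfl)
  · exact x.2.2.1 _ _ _ (by decide)
  · exact x.2.1 _ _ (by decide)

theorem coord₁_degen (x : D.V _⦋0⦌) : D.coord₁ (D.V.degen 0 x) = (0, D.coord₀ x) := by
  refine Prod.ext ?_ rfl
  exact x.2.1 _ _ (by decide)

theorem coord₀_face_zero (x : D.V _⦋1⦌) : D.coord₀ (D.V.face 0 x) = (D.coord₁ x).2 := rfl

theorem coord₀_face_one (x : D.V _⦋1⦌) :
    D.coord₀ (D.V.face 1 x) = (D.coord₁ x).2 - D.bdry (D.coord₁ x).1 := by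
  have := x.2.2.2.1 0 1 (by decide)
  have e : D.bdry (D.coord₁ x).1 = x.1.1 1 - x.1.1 0 := this
  rw [e]
  exact (sub_sub_cancel _ _).symm

theorem coord₁_face_two (x : D.V _⦋2⦌) : D.coord₁ (D.V.face 2 x) =
    (D.bdryStar (D.coord₂ x).1 + (D.coord₂ x).2.2.1 - (D.coord₂ x).2.1,
      (D.coord₂ x).2.2.2 - D.bdry (D.coord₂ x).2.1) := by
  have hb : D.bdryStar (D.coord₂ x).1 = x.1.2.1 1 2 - x.1.2.1 0 2 + x.1.2.1 0 1 :=
    x.2.2.2.2.1 0 1 2 (by decide) (by decide)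
  have ha : D.bdry (D.coord₂ x).2.1 = x.1.1 2 - x.1.1 1 := x.2.2.2.1 1 2 (by decide)
  rw [hb, ha]
  refine Prod.ext ?_ (sub_sub_cancel _ _).symm
  change x.1.2.1 0 1 = x.1.2.1 1 2 - x.1.2.1 0 2 + x.1.2.1 0 1 + x.1.2.1 0 2 - x.1.2.1 1 2
  abel

theorem form_normalized : SimplicialVect.IsNormalized D.form := by
  intro i u v
  have s := D.symm.eq (D.coord₁ u).1 (D.coord₁ v).1
  fin_cases i
  · change D.form (D.V.degen 0 u) (D.V.degen 0 v) = 0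
    rw [form_apply, coord₂_degen_zero, coord₂_degen_zero]
    simp
  · change D.form (D.V.degen 1 u) (D.V.degen 1 v) = 0
    rw [form_apply, coord₂_degen_one, coord₂_degen_one]
    simp

theorem form_nondegenerate : SimplicialVect.IsSimpliciallyNondegenerate D.form where
  left v hv := by
    apply D.coord₀.injective
    rw [map_zero, ← Module.forall_dual_apply_eq_zero_iff ℝ]
    intro ξ
    have := hv (D.coord₂.symm (ξ, 0, 0, 0))
    simp [SimplicialVect.pairingA, form_apply, coord₂_degen_zero, coord₁_degen] at this
    exact this
  right w hw := by
    have h : (D.coord₂ w).1 = 0 := by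
      ext v
      have := hw (D.coord₀.symm v)
      simpa [SimplicialVect.pairingA, form_apply, coord₂_degen_zero, coord₁_degen] using this
    rw [Submodule.mem_sup]
    refine ⟨_, ⟨D.coord₁.symm ((D.coord₂ w).2.1, 0), rfl⟩, _,
      ⟨D.coord₁.symm ((D.coord₂ w).2.2.1 - (D.coord₂ w).2.1, (D.coord₂ w).2.2.2), rfl⟩, ?_⟩
    apply D.coord₂.injective
    rw [map_add, coord₂_degen_zero, coord₂_degen_one]
    refine Prod.ext ?_ ?_
    · simp [h]
    · simp
  mid θ hθ := by
    have h : (D.coord₁ θ).1 = 0 := by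
      apply D.nondegenerate.1
      intro w
      have s := D.symm.eq w (D.coord₁ θ).1
      have := hθ (D.coord₁.symm (w, 0))
      simp [SimplicialVect.pairingB, form_apply, coord₂_degen_zero, coord₂_degen_one] at this s
      linarith
    refine ⟨D.coord₀.symm (D.coord₁ θ).2, ?_⟩
    apply D.coord₁.injective
    rw [coord₁_degen]
    simp [← h]

/-- The pairing of `V_0` with `V_2` is the canonical pairing of `W₀` with `W₀^*`. -/
theorem pairingA_form (v : D.V _⦋0⦌) (w : D.V _⦋2⦌) :
    SimplicialVect.pairingA D.form v w = (D.coord₂ w).1 (D.coord₀ v) := by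
  simp [SimplicialVect.pairingA, form_apply, coord₂_degen_zero, coord₁_degen]

/-- The symmetric form induced on `V_1` is the pairing of `W₁`. -/
theorem pairingB_form (θ η : D.V _⦋1⦌) :
    SimplicialVect.pairingB D.form θ η = D.pairing (D.coord₁ θ).1 (D.coord₁ η).1 := by
  have s := D.symm.eq (D.coord₁ η).1 (D.coord₁ θ).1
  simp [SimplicialVect.pairingB, form_apply, coord₂_degen_zero, coord₂_degen_one] at s ⊢
  rw [s]
  ring

theorem form_multiplicative : SimplicialVect.IsMultiplicative D.form := by
  intro u v
  have hc : ∀ x : D.V _⦋3⦌, x.1.2.2 0 1 2 = x.1.2.2 1 2 3 - x.1.2.2 0 2 3 + x.1.2.2 0 1 3 :=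
    fun x => (sub_eq_zero.mp (x.2.2.2.2.2 0 1 2 3 (by decide) (by decide) (by decide))).symm
  have hb : ∀ (x : D.V _⦋3⦌) (i : Fin 4), i ≤ 2 →
      x.1.2.1 i 2 = D.bdryStar (x.1.2.2 i 2 3) - x.1.2.1 2 3 + x.1.2.1 i 3 := by
    intro x i hi
    have : D.bdryStar (x.1.2.2 i 2 3) = x.1.2.1 2 3 - x.1.2.1 i 3 + x.1.2.1 i 2 :=
      x.2.2.2.2.1 i 2 3 hi (by decide)
    rw [this]; abel
  have ha : ∀ x : D.V _⦋3⦌, x.1.1 2 = x.1.1 3 - D.bdry (x.1.2.1 2 3) := by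
    intro x
    have : D.bdry (x.1.2.1 2 3) = x.1.1 3 - x.1.1 2 := x.2.2.2.1 2 3 (by decide)
    rw [this]; abel
  have f0 : ∀ x : D.V _⦋3⦌, D.coord₂ (D.V.face 0 x) =
      (x.1.2.2 1 2 3, x.1.2.1 2 3, x.1.2.1 1 3, x.1.1 3) := fun _ => rfl
  have f1 : ∀ x : D.V _⦋3⦌, D.coord₂ (D.V.face 1 x) =
      (x.1.2.2 0 2 3, x.1.2.1 2 3, x.1.2.1 0 3, x.1.1 3) := fun _ => rfl
  have f2 : ∀ x : D.V _⦋3⦌, D.coord₂ (D.V.face 2 x) =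
      (x.1.2.2 0 1 3, x.1.2.1 1 3, x.1.2.1 0 3, x.1.1 3) := fun _ => rfl
  have f3 : ∀ x : D.V _⦋3⦌, D.coord₂ (D.V.face 3 x) =
      (x.1.2.2 0 1 2, x.1.2.1 1 2, x.1.2.1 0 2, x.1.1 2) := fun _ => rfl
  rw [Fin.sum_univ_four]
  rw [form_apply, form_apply, form_apply, form_apply, f0, f0, f1, f1, f2, f2, f3, f3]
  dsimp only
  rw [hc u, hc v, hb u 1 (by decide), hb u 0 (by decide), hb v 1 (by decide), hb v 0 (by decide),
    ha u, ha v]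
  have s := D.symm.eq (u.1.2.1 2 3) (v.1.2.1 2 3)
  simp only [map_add, map_sub, LinearMap.add_apply, LinearMap.sub_apply, pairing_bdryStar,
    pairing_bdryStar_right, bdry_bdryStar, map_zero]
  simp
  rw [s]
  ring

/-- The symmetric constant symplectic 2-groupoid corresponding to `(W₁, W₀, ⟨·,·⟩, ∂)`. -/
def symplecticTwoGroupoid [FiniteDimensional ℝ W₀] : ConstantSymplecticTwoGroupoid.{max u v} where
  V := D.V
  isTwoGroupoid := complexSimplicialVect_isTwoGroupoid
  ω := D.form
  alt := D.form_alt
  multiplicative := D.form_multiplicative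
  normalized := D.form_normalized
  nondegenerate := D.form_nondegenerate

theorem symplecticTwoGroupoid_isSymmetric [FiniteDimensional ℝ W₀] :
    D.symplecticTwoGroupoid.IsSymmetric := by
  intro (w : D.V _⦋1⦌) (w' : D.V _⦋1⦌) _ _
  have s := D.symm.eq (D.coord₁ w).1 (D.coord₁ w').1
  change D.form (D.V.degen 1 w) (D.V.degen 0 w' - D.V.degen 1 w') =
    D.form (D.V.degen 1 w') (D.V.degen 0 w - D.V.degen 1 w)
  rw [map_sub, map_sub, D.form_normalized 1, D.form_normalized 1, form_apply, form_apply,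
    coord₂_degen_zero, coord₂_degen_zero, coord₂_degen_one, coord₂_degen_one]
  simp [s]

end Groupoid

end CourantData

/-! ### Constant Courant algebroids -/

/-- Smooth sections of the trivial bundle `E × M → M` over a vector space `M`, i.e. smooth maps
`M → E`. -/
def smoothSections (M : Type u) (E : Type v) [NormedAddCommGroup M] [NormedSpace ℝ M]
    [NormedAddCommGroup E] [NormedSpace ℝ E] : Submodule ℝ (M → E) where
  carrier := {e | ContDiff ℝ (⊤ : ℕ∞) e}
  add_mem' {e e'} (h : ContDiff ℝ (⊤ : ℕ∞) e) (h' : ContDiff ℝ (⊤ : ℕ∞) e') := by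
    change ContDiff ℝ (⊤ : ℕ∞) fun x => e x + e' x
    exact h.add h'
  zero_mem' := by
    change ContDiff ℝ (⊤ : ℕ∞) fun _ : M => (0 : E)
    exact contDiff_const
  smul_mem' c {e} (h : ContDiff ℝ (⊤ : ℕ∞) e) := by
    change ContDiff ℝ (⊤ : ℕ∞) fun x => c • e x
    exact h.const_smul c

section Courant

variable {W₀ : Type u} {W₁ : Type v} [NormedAddCommGroup W₀] [NormedSpace ℝ W₀]
  [NormedAddCommGroup W₁] [NormedSpace ℝ W₁]

theorem contDiff_section (e : smoothSections W₀ W₁) : ContDiff ℝ (⊤ : ℕ∞) e.1 := e.2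

/-- The product `f e` of a smooth function with a smooth section. -/
def smoothSections.mulFun (f : smoothSections W₀ ℝ) (e : smoothSections W₀ W₁) :
    smoothSections W₀ W₁ :=
  ⟨fun x => f.1 x • e.1 x, by
    change ContDiff ℝ (⊤ : ℕ∞) fun x => f.1 x • e.1 x
    exact (contDiff_section f).smul (contDiff_section e)⟩

/-- The constant section with value `w`. -/
def smoothSections.const (w : W₁) : smoothSections W₀ W₁ := ⟨fun _ => w, by
  change ContDiff ℝ (⊤ : ℕ∞) fun _ : W₀ => w
  exact contDiff_const⟩

variable (W₀ W₁) in
/-- A constant Courant algebroid `W₁ × W₀ → W₀`. The pairing `⟨·,·⟩` and the anchor `ρ` do not depend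
on the base point, so they are a bilinear form on `W₁` and a linear map `W₁ → W₀`. The derivative
`ρ(e)(f)` at `x` is `fderiv ℝ f x (anchor (e x))`. -/
structure ConstantCourantAlgebroid where
  pairing : LinearMap.BilinForm ℝ W₁
  symm : pairing.IsSymm
  nondegenerate : pairing.Nondegenerate
  anchor : W₁ →ₗ[ℝ] W₀
  /-- The Courant bracket on sections. -/
  bracket : smoothSections W₀ W₁ →ₗ[ℝ] smoothSections W₀ W₁ →ₗ[ℝ] smoothSections W₀ W₁
  /-- `⟦e₁, f e₂⟧ = ρ(e₁)(f) e₂ + f ⟦e₁, e₂⟧` -/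
  leibniz : ∀ (e₁ e₂ : smoothSections W₀ W₁) (f : smoothSections W₀ ℝ) (x : W₀),
    (bracket e₁ (smoothSections.mulFun f e₂)).1 x =
      fderiv ℝ f.1 x (anchor (e₁.1 x)) • e₂.1 x + f.1 x • (bracket e₁ e₂).1 x
  /-- `ρ(e₁)⟨e₂, e₃⟩ = ⟨⟦e₁, e₂⟧, e₃⟩ + ⟨e₂, ⟦e₁, e₃⟧⟩` -/
  invariance : ∀ (e₁ e₂ e₃ : smoothSections W₀ W₁) (x : W₀),
    fderiv ℝ (fun y => pairing (e₂.1 y) (e₃.1 y)) x (anchor (e₁.1 x)) =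
      pairing ((bracket e₁ e₂).1 x) (e₃.1 x) + pairing (e₂.1 x) ((bracket e₁ e₃).1 x)
  /-- `⟦⟦e₁, e₂⟧, e₃⟧ = ⟦e₁, ⟦e₂, e₃⟧⟧ - ⟦e₂, ⟦e₁, e₃⟧⟧` -/
  jacobi : ∀ e₁ e₂ e₃ : smoothSections W₀ W₁,
    bracket (bracket e₁ e₂) e₃ = bracket e₁ (bracket e₂ e₃) - bracket e₂ (bracket e₁ e₃)
  /-- `⟦e₁, e₂⟧ + ⟦e₂, e₁⟧ = 𝒟⟨e₁, e₂⟩`, where `𝒟 f` is defined by `⟨𝒟 f, e⟩ = ρ(e)(f)` -/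
  symmetrization : ∀ (e₁ e₂ e₃ : smoothSections W₀ W₁) (x : W₀),
    pairing ((bracket e₁ e₂ + bracket e₂ e₁).1 x) (e₃.1 x) =
      fderiv ℝ (fun y => pairing (e₁.1 y) (e₂.1 y)) x (anchor (e₃.1 x))
  /-- The bracket of constant sections vanishes. -/
  bracket_const : ∀ w w' : W₁,
    bracket (smoothSections.const w) (smoothSections.const w') = 0

/-- A family of subspaces `D_x ⊆ W₁`, `x ∈ W₀`, is a smooth subbundle of `W₁ × W₀` if it has a smooth
frame near every point. -/
def IsSmoothSubbundle (D : W₀ → Submodule ℝ W₁) : Prop :=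
  ∀ x : W₀, ∃ N : Set W₀, IsOpen N ∧ x ∈ N ∧ ∃ (r : ℕ) (s : Fin r → W₀ → W₁),
    (∀ i, ContDiffOn ℝ (⊤ : ℕ∞) (s i) N) ∧
    ∀ y ∈ N, LinearIndependent ℝ (fun i => s i y) ∧
      Submodule.span ℝ (Set.range fun i => s i y) = D y

/-- A Dirac structure: a subbundle `D` with `D^⊥ = D` whose sections are closed under the Courant
bracket. -/
structure ConstantCourantAlgebroid.IsDirac (E : ConstantCourantAlgebroid W₀ W₁)
    (D : W₀ → Submodule ℝ W₁) : Prop where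
  subbundle : IsSmoothSubbundle D
  orthogonal : ∀ x w, w ∈ D x ↔ ∀ u ∈ D x, E.pairing u w = 0
  involutive : ∀ e₁ e₂ : smoothSections W₀ W₁, (∀ x, e₁.1 x ∈ D x) → (∀ x, e₂.1 x ∈ D x) →
    ∀ x, (E.bracket e₁ e₂).1 x ∈ D x

/-- A constant Dirac structure `U × W₀`, given by a subspace `U` of `W₁`. -/
def ConstantCourantAlgebroid.IsConstantDirac (E : ConstantCourantAlgebroid W₀ W₁)
    (U : Submodule ℝ W₁) : Prop :=
  E.IsDirac fun _ => U

namespace CourantData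

variable [FiniteDimensional ℝ W₀] [FiniteDimensional ℝ W₁] (D : CourantData W₀ W₁)

/-- The bilinear operation `(A, b) ↦ ∂^*⟨A ·, b⟩` for `A : W₀ → W₁` linear and `b ∈ W₁`. -/
def starPairing : (W₀ →L[ℝ] W₁) →ₗ[ℝ] W₁ →ₗ[ℝ] W₁ :=
  LinearMap.mk₂ ℝ (fun A b => D.bdryStar (D.pairing.flip b ∘ₗ A.toLinearMap))
    (by intros; rw [← map_add]; congr 1; ext; simp)
    (by intros; rw [← map_smul]; congr 1; ext; simp)
    (by intros; rw [← map_add]; congr 1; ext; simp)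
    (by intros; rw [← map_smul]; congr 1; ext; simp)

theorem pairing_starPairing (A : W₀ →L[ℝ] W₁) (b w : W₁) :
    D.pairing (D.starPairing A b) w = D.pairing (A (D.bdry w)) b := by
  simp [starPairing, pairing_bdryStar]

theorem bdry_starPairing (A : W₀ →L[ℝ] W₁) (b : W₁) : D.bdry (D.starPairing A b) = 0 := by
  simp [starPairing, bdry_bdryStar]

/-- The Courant bracket of two sections. Writing `∇` for the derivative of maps `W₀ → W₁`, it is
`⟦e₁, e₂⟧ = ∇_{∂e₁} e₂ - ∇_{∂e₂} e₁ + ∂^*⟨∇e₁, e₂⟩`; on sections of the form `f w`, `g w'` with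
functions `f, g` and constants `w, w'` this reads
`⟦f w, g w'⟧ = f ρ(w)(g) w' - g ρ(w')(f) w + g ⟨w, w'⟩ 𝒟 f`, where `𝒟 f = ∂^* df`. -/
def bracketFun (e₁ e₂ : W₀ → W₁) (x : W₀) : W₁ :=
  fderiv ℝ e₂ x (D.bdry (e₁ x)) - fderiv ℝ e₁ x (D.bdry (e₂ x)) +
    D.starPairing (fderiv ℝ e₁ x) (e₂ x)

theorem contDiff_bracketFun (e₁ e₂ : smoothSections W₀ W₁) :
    ContDiff ℝ (⊤ : ℕ∞) (D.bracketFun e₁.1 e₂.1) := by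
  have h : ∀ e : smoothSections W₀ W₁, ContDiff ℝ (⊤ : ℕ∞) (fderiv ℝ e.1) := fun e =>
    (contDiff_section e).fderiv_right le_rfl
  have h' : ∀ e : smoothSections W₀ W₁, ContDiff ℝ (⊤ : ℕ∞) fun x => D.bdry (e.1 x) := fun e =>
    D.bdry.toContinuousLinearMap.contDiff.comp (contDiff_section e)
  refine (((h e₂).clm_apply (h' e₁)).sub ((h e₁).clm_apply (h' e₂))).add ?_
  exact (D.starPairing.toContinuousBilinearMap.contDiff.comp (h e₁)).clm_apply (contDiff_section e₂)

theorem differentiable_section (e : smoothSections W₀ W₁) : Differentiable ℝ e.1 :=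
  (contDiff_section e).differentiable (by simp)

theorem fderiv_bracketFun (e₁ e₂ : smoothSections W₀ W₁) (x v : W₀) :
    fderiv ℝ (D.bracketFun e₁.1 e₂.1) x v =
      fderiv ℝ (fderiv ℝ e₂.1) x v (D.bdry (e₁.1 x))
        + fderiv ℝ e₂.1 x (D.bdry (fderiv ℝ e₁.1 x v))
        - fderiv ℝ (fderiv ℝ e₁.1) x v (D.bdry (e₂.1 x))
        - fderiv ℝ e₁.1 x (D.bdry (fderiv ℝ e₂.1 x v))
        + D.starPairing (fderiv ℝ (fderiv ℝ e₁.1) x v) (e₂.1 x)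
        + D.starPairing (fderiv ℝ e₁.1 x) (fderiv ℝ e₂.1 x v) := by
  have h : ∀ e : smoothSections W₀ W₁, HasFDerivAt e.1 (fderiv ℝ e.1 x) x := fun e =>
    (differentiable_section e x).hasFDerivAt
  have h' : ∀ e : smoothSections W₀ W₁,
      HasFDerivAt (fderiv ℝ e.1) (fderiv ℝ (fderiv ℝ e.1) x) x := fun e =>
    ((((contDiff_section e).fderiv_right (m := (⊤ : ℕ∞)) le_rfl).differentiable (by simp)) x).hasFDerivAt
  have hb : ∀ e : smoothSections W₀ W₁, HasFDerivAt (fun y => D.bdry (e.1 y))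
      (D.bdry.toContinuousLinearMap.comp (fderiv ℝ e.1 x)) x := fun e =>
    D.bdry.toContinuousLinearMap.hasFDerivAt.comp x (h e)
  have hs := ((D.starPairing.toContinuousBilinearMap.hasFDerivAt.comp x (h' e₁))).clm_apply (h e₂)
  have H := (((h' e₂).clm_apply (hb e₁)).sub ((h' e₁).clm_apply (hb e₂))).add hs
  have H' : HasFDerivAt (D.bracketFun e₁.1 e₂.1) _ x := H
  rw [H'.fderiv]
  simp
  abel

theorem fderiv_pairing (e₁ e₂ : smoothSections W₀ W₁) (x v : W₀) :
    fderiv ℝ (fun y => D.pairing (e₁.1 y) (e₂.1 y)) x v =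
      D.pairing (fderiv ℝ e₁.1 x v) (e₂.1 x) + D.pairing (e₁.1 x) (fderiv ℝ e₂.1 x v) := by
  have h : ∀ e : smoothSections W₀ W₁, HasFDerivAt e.1 (fderiv ℝ e.1 x) x := fun e =>
    (differentiable_section e x).hasFDerivAt
  have H := (D.pairing.toContinuousBilinearMap.hasFDerivAt.comp x (h e₁)).clm_apply (h e₂)
  have H' : HasFDerivAt (fun y => D.pairing (e₁.1 y) (e₂.1 y)) _ x := H
  rw [H'.fderiv]
  simp
  abel

theorem fderiv_fderiv_symm (e : smoothSections W₀ W₁) (x u v : W₀) :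
    fderiv ℝ (fderiv ℝ e.1) x u v = fderiv ℝ (fderiv ℝ e.1) x v u :=
  ((contDiff_section e).contDiffAt.isSymmSndFDerivAt (by
    rw [minSmoothness_of_isRCLikeNormedField]
    exact WithTop.coe_le_coe.2 le_top)).eq u v

theorem ext_pairing {w w' : W₁} (h : ∀ u, D.pairing w u = D.pairing w' u) : w = w' := by
  rw [← sub_eq_zero]
  apply D.nondegenerate.1
  intro u
  simp [h u]

theorem bracketFun_mulFun_const (f g : smoothSections W₀ ℝ) (w w' : W₁) (x : W₀) :
    D.bracketFun (smoothSections.mulFun f (smoothSections.const w)).1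
      (smoothSections.mulFun g (smoothSections.const w')).1 x =
      (f.1 x * fderiv ℝ g.1 x (D.bdry w)) • w' - (g.1 x * fderiv ℝ f.1 x (D.bdry w')) • w +
        (g.1 x * D.pairing w w') • D.bdryStar (fderiv ℝ f.1 x).toLinearMap := by
  have h : ∀ (e : smoothSections W₀ ℝ) (u : W₁),
      fderiv ℝ (fun y => e.1 y • u) x = (fderiv ℝ e.1 x).smulRight u := fun e u =>
    (((contDiff_section e).differentiable (by simp) x).hasFDerivAt.smul_const u).fderiv
  apply D.ext_pairing
  intro u
  simp only [bracketFun, smoothSections.mulFun, smoothSections.const, h, map_add, map_sub, map_smul,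
    LinearMap.add_apply, LinearMap.sub_apply, LinearMap.smul_apply, pairing_starPairing,
    pairing_bdryStar, ContinuousLinearMap.smulRight_apply, smul_eq_mul, ContinuousLinearMap.coe_coe]
  ring

/-- The constant Courant algebroid `W₁ × W₀ → W₀` corresponding to `(W₁, W₀, ⟨·,·⟩, ∂)`. -/
def courantAlgebroid : ConstantCourantAlgebroid W₀ W₁ where
  pairing := D.pairing
  symm := D.symm
  nondegenerate := D.nondegenerate
  anchor := D.bdry
  bracket := LinearMap.mk₂ ℝ (fun e₁ e₂ => ⟨D.bracketFun e₁.1 e₂.1, D.contDiff_bracketFun e₁ e₂⟩)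
    (by
      intro e₁ e₂ e₃
      apply Subtype.ext
      funext x
      have : fderiv ℝ (e₁.1 + e₂.1) x = fderiv ℝ e₁.1 x + fderiv ℝ e₂.1 x :=
        fderiv_add (differentiable_section e₁ x) (differentiable_section e₂ x)
      simp [bracketFun, this]
      abel)
    (by
      intro c e₁ e₂
      apply Subtype.ext
      funext x
      have : fderiv ℝ (c • e₁.1) x = c • fderiv ℝ e₁.1 x :=
        fderiv_const_smul (differentiable_section e₁ x) c
      simp [bracketFun, this, smul_add, smul_sub])
    (by
      intro e₁ e₂ e₃
      apply Subtype.ext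
      funext x
      have : fderiv ℝ (e₂.1 + e₃.1) x = fderiv ℝ e₂.1 x + fderiv ℝ e₃.1 x :=
        fderiv_add (differentiable_section e₂ x) (differentiable_section e₃ x)
      simp [bracketFun, this]
      abel)
    (by
      intro c e₁ e₂
      apply Subtype.ext
      funext x
      have : fderiv ℝ (c • e₂.1) x = c • fderiv ℝ e₂.1 x :=
        fderiv_const_smul (differentiable_section e₂ x) c
      simp [bracketFun, this, smul_add, smul_sub])
  leibniz := by
    intro e₁ e₂ f x
    have hf : DifferentiableAt ℝ f.1 x := differentiable_section f x
    have : fderiv ℝ (fun y => f.1 y • e₂.1 y) x = _ :=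
      (hf.hasFDerivAt.smul (differentiable_section e₂ x).hasFDerivAt).fderiv
    simp [bracketFun, smoothSections.mulFun, this, smul_add, smul_sub]
    abel
  invariance := by
    intro e₁ e₂ e₃ x
    rw [fderiv_pairing]
    have s1 := D.symm.eq (e₂.1 x) (D.starPairing (fderiv ℝ e₁.1 x) (e₃.1 x))
    have s2 := D.symm.eq (e₂.1 x) (fderiv ℝ e₁.1 x (D.bdry (e₃.1 x)))
    simp [bracketFun, pairing_starPairing] at s1 s2 ⊢
    linarith
  jacobi := by
    intro e₁ e₂ e₃
    apply Subtype.ext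
    funext x
    apply D.ext_pairing
    intro w
    have hsym : ∀ u v, D.pairing u v = D.pairing v u := fun u v => D.symm.eq u v
    have hS : ∀ (A : W₀ →L[ℝ] W₁) (b u : W₁),
        D.pairing u (D.starPairing A b) = D.pairing (A (D.bdry u)) b := fun A b u => by
      rw [hsym, pairing_starPairing]
    have F12 := D.fderiv_bracketFun e₁ e₂ x
    have F23 := D.fderiv_bracketFun e₂ e₃ x
    have F13 := D.fderiv_bracketFun e₁ e₃ x
    have G : ∀ e e' : smoothSections W₀ W₁, D.bdry (D.bracketFun e.1 e'.1 x) =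
        D.bdry (fderiv ℝ e'.1 x (D.bdry (e.1 x))) - D.bdry (fderiv ℝ e.1 x (D.bdry (e'.1 x))) := by
      intro e e'
      simp [bracketFun, bdry_starPairing]
    change D.pairing (D.bracketFun (D.bracketFun e₁.1 e₂.1) e₃.1 x) w =
      D.pairing (D.bracketFun e₁.1 (D.bracketFun e₂.1 e₃.1) x -
        D.bracketFun e₂.1 (D.bracketFun e₁.1 e₃.1) x) w
    have B1 : ∀ (e : W₀ → W₁) (e' : smoothSections W₀ W₁), D.bracketFun e e'.1 x =
        fderiv ℝ e'.1 x (D.bdry (e x)) - fderiv ℝ e x (D.bdry (e'.1 x)) +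
          D.starPairing (fderiv ℝ e x) (e'.1 x) := fun _ _ => rfl
    have B2 : ∀ (e : smoothSections W₀ W₁) (e' : W₀ → W₁), D.bracketFun e.1 e' x =
        fderiv ℝ e' x (D.bdry (e.1 x)) - fderiv ℝ e.1 x (D.bdry (e' x)) +
          D.starPairing (fderiv ℝ e.1 x) (e' x) := fun _ _ => rfl
    rw [B1 _ e₃, B2 e₁ (D.bracketFun e₂.1 e₃.1), B2 e₂ (D.bracketFun e₁.1 e₃.1), G, G, G,
      F12, F23, F13]
    simp only [map_add, map_sub, LinearMap.add_apply, LinearMap.sub_apply, pairing_starPairing, F12]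
    rw [B1 _ e₃, B1 _ e₃]
    simp only [map_add, map_sub, hS]
    rw [fderiv_fderiv_symm e₁ x (D.bdry (e₃.1 x)) (D.bdry (e₂.1 x)),
      fderiv_fderiv_symm e₂ x (D.bdry (e₃.1 x)) (D.bdry (e₁.1 x)),
      fderiv_fderiv_symm e₃ x (D.bdry (e₂.1 x)) (D.bdry (e₁.1 x)),
      fderiv_fderiv_symm e₂ x (D.bdry (e₁.1 x)) (D.bdry w),
      fderiv_fderiv_symm e₁ x (D.bdry (e₂.1 x)) (D.bdry w),
      fderiv_fderiv_symm e₁ x (D.bdry (e₃.1 x)) (D.bdry w)]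
    rw [hsym (fderiv ℝ e₂.1 x (D.bdry w)) (fderiv ℝ e₁.1 x (D.bdry (e₃.1 x)))]
    ring
  symmetrization := by
    intro e₁ e₂ e₃ x
    rw [fderiv_pairing]
    have s := D.symm.eq (e₁.1 x) (fderiv ℝ e₂.1 x (D.bdry (e₃.1 x)))
    simp [bracketFun, pairing_starPairing] at s ⊢
    linarith
  bracket_const := by
    intro w w'
    apply Subtype.ext
    funext x
    simp [bracketFun, smoothSections.const]

end CourantData

end Courant

end

/-! Both sides are parametrised by the subspaces `U` of `W₁` with `U = U^⊥`, so the proof matches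
each with that linear-algebra condition.

On the Dirac side, involutivity costs nothing (`isConstantDirac_iff`). Sections with values in `U`
have derivatives in `U`, so the two derivative terms of the bracket stay in `U`, while `∂^*⟨∇e₁,
e₂⟩` vanishes because `U` is isotropic.

On the groupoid side, `U` gives the simplices whose edge labels lie in `U` and whose triangle labels
vanish (`labelSubspace`). On triangles `(0, w₁, w₁', w₀)` the form is `½(⟨w₁', u₁⟩ - ⟨w₁, u₁'⟩)`,
and from this the Lagrangian condition becomes `U = U^⊥`.

Conversely, let `L` be wide and Lagrangian, with `U` its edge labels. Width puts all degenerate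
simplices on points into `L`. Pairing these with `L_2` kills the `W₀^*` component
(`coord₂_fst_eq_zero`), and what remains is a sum of degenerate triangles on edges of `L`. Hence
`L_1` determines `L_2` (`mem_obj_two_iff`), and unique horn filling determines everything above
(`labelSubspace_edgeLabels`). -/

/-! ### Constant subbundles and derivatives of their sections. -/

theorem isSmoothSubbundle_const {W₀ : Type u} {W₁ : Type v}
    [NormedAddCommGroup W₀] [NormedSpace ℝ W₀] [NormedAddCommGroup W₁] [NormedSpace ℝ W₁]
    [FiniteDimensional ℝ W₁] (U : Submodule ℝ W₁) :
    IsSmoothSubbundle fun _ : W₀ => U := by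
  intro x
  let b := Module.finBasis ℝ U
  refine ⟨Set.univ, isOpen_univ, trivial, _, fun i _ => (b i : W₁),
    fun i => contDiffOn_const, fun y _ => ⟨?_, ?_⟩⟩
  · exact b.linearIndependent.map' U.subtype U.ker_subtype
  · have h := congrArg (Submodule.map U.subtype) b.span_eq
    rw [Submodule.map_span, Submodule.map_top, Submodule.range_subtype, ← Set.range_comp] at h
    exact h

/-- The derivative of a map with values in a subspace takes values in that subspace. -/
theorem fderiv_mem_of_forall_mem {W₀ : Type u} {W₁ : Type v}
    [NormedAddCommGroup W₀] [NormedSpace ℝ W₀] [NormedAddCommGroup W₁] [NormedSpace ℝ W₁]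
    [FiniteDimensional ℝ W₁] {U : Submodule ℝ W₁} {e : W₀ → W₁}
    (he : Differentiable ℝ e) (h : ∀ x, e x ∈ U) (x v : W₀) : fderiv ℝ e x v ∈ U := by
  -- `P` is a linear retraction of `W₁` onto `U`, and `Q` is the same map viewed in `W₁`. Since `Q ∘
  -- e = e`, the chain rule shows that the derivative of `e` is fixed by `Q`, hence lies in `U`.
  obtain ⟨P, hP⟩ := LinearMap.exists_extend (LinearMap.id : U →ₗ[ℝ] U)
  let Q : W₁ →L[ℝ] W₁ := (U.subtype ∘ₗ P).toContinuousLinearMap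
  have hQ : HasFDerivAt (fun y => Q (e y)) (Q.comp (fderiv ℝ e x)) x :=
    Q.hasFDerivAt.comp x (he x).hasFDerivAt
  have hQe : (fun y => Q (e y)) = e := by
    funext y
    exact congrArg Subtype.val (LinearMap.congr_fun hP ⟨e y, h y⟩)
  rw [hQe] at hQ
  rw [hQ.fderiv]
  exact (P (fderiv ℝ e x v)).2

/-! ### Simplicial subspaces of a linear 2-groupoid. -/

namespace SimplicialSubspace

variable {V : SimplicialVect.{u}} (L : SimplicialSubspace V)

theorem face_mem {n : ℕ} (i : Fin (n + 2)) {x : V _⦋n + 1⦌} (hx : x ∈ L.obj (n + 1)) :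
    V.face i x ∈ L.obj n :=
  L.map_mem (SimplexCategory.δ i) x hx

theorem degen_mem {n : ℕ} (i : Fin (n + 1)) {x : V _⦋n⦌} (hx : x ∈ L.obj n) :
    V.degen i x ∈ L.obj (n + 1) :=
  L.map_mem (SimplexCategory.σ i) x hx

/-- Every simplicial subspace of a linear 2-groupoid is a sub-2-groupoid. -/
theorem isSubTwoGroupoid (hV : V.IsTwoGroupoid) : L.IsSubTwoGroupoid where
  finite n := by
    have := hV.finite n
    exact inferInstanceAs (Module.Finite ℝ (L.obj n))
  -- Horns fill in every simplicial vector space; only uniqueness has to be inherited from `V`.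
  fill := SimplicialVect.exists_filler
  unique q k y y' hq h := by
    refine Subtype.ext (hV.unique q k y.1 y'.1 hq fun i hi => ?_)
    exact congrArg Subtype.val (h i hi)

/-- In dimension greater than two, a simplex of a linear 2-groupoid belongs to a sub-2-groupoid
once all its faces do. -/
theorem mem_of_forall_face_mem (hV : V.IsTwoGroupoid) (hL : L.IsSubTwoGroupoid) {n : ℕ}
    {x : V _⦋n + 3⦌} (hx : ∀ i, V.face i x ∈ L.obj (n + 2)) : x ∈ L.obj (n + 3) := by
  -- The faces of `x` other than the 0th form a horn in `L`. Its filler in `L` also fills this horn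
  -- in `V`, as does `x`, so the two agree by uniqueness in dimension at least 3.
  obtain ⟨y, hy⟩ := hL.fill (n + 2) 0 (fun i => ⟨V.face i.1 x, hx i.1⟩) (by
    intro i j hi hj hij
    exact Subtype.ext (SimplicialVect.face_face hij x))
  have : y.1 = x := hV.unique (n + 2) 0 y.1 x (by omega) fun i hi =>
    congrArg Subtype.val (hy ⟨i, hi⟩)
  exact this ▸ y.2

end SimplicialSubspace

/-! ### From self-orthogonal subspaces to wide Lagrangian sub-2-groupoids. -/

namespace CourantData

section Groupoid

variable {W₀ : Type u} {W₁ : Type v} [AddCommGroup W₀] [Module ℝ W₀]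
  [AddCommGroup W₁] [Module ℝ W₁] [FiniteDimensional ℝ W₁] (D : CourantData W₀ W₁)

/-- A subspace of `W₁` that equals its own orthogonal. -/
noncomputable def IsSelfOrthogonal (U : Submodule ℝ W₁) : Prop :=
  ∀ w, w ∈ U ↔ ∀ u ∈ U, D.pairing u w = 0

/-- The simplicial subspace of simplices with edge labels in `U` and vanishing triangle labels. -/
noncomputable def labelSubspace (U : Submodule ℝ W₁) : SimplicialSubspace D.V where
  obj n :=
    { carrier := {x |
        (∀ i j, x.1.2.1 i j ∈ U) ∧ ∀ i j k, x.1.2.2 i j k = 0}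
      zero_mem' := ⟨fun _ _ => U.zero_mem, fun _ _ _ => rfl⟩
      add_mem' := fun {x y} hx hy => ⟨fun i j => U.add_mem (hx.1 i j) (hy.1 i j), fun i j k => by
        change x.1.2.2 i j k + y.1.2.2 i j k = 0
        rw [hx.2, hy.2, add_zero]⟩
      smul_mem' := fun r x hx => ⟨fun i j => U.smul_mem r (hx.1 i j), fun i j k => by
        change r • x.1.2.2 i j k = 0
        rw [hx.2, smul_zero]⟩ }
  map_mem θ x hx := ⟨fun i j => hx.1 (θ.toOrderHom i) (θ.toOrderHom j),
    fun i j k => hx.2 (θ.toOrderHom i) (θ.toOrderHom j) (θ.toOrderHom k)⟩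

/-- An edge has one label that is not forced to be zero; every other pair or triple of its vertices
fails to be increasing. -/
theorem mem_labelSubspace_one (U : Submodule ℝ W₁) (x : D.V _⦋1⦌) :
    x ∈ (D.labelSubspace U).obj 1 ↔ (D.coord₁ x).1 ∈ U := by
  refine ⟨fun h => h.1 0 1, fun h => ⟨fun (i : Fin 2) (j : Fin 2) => ?_,
    fun (i : Fin 2) (j : Fin 2) (k : Fin 2) => x.2.2.1 i j k (by revert i j k; decide)⟩⟩
  by_cases hij : i < j
  · obtain ⟨rfl, rfl⟩ : i = 0 ∧ j = 1 := by revert i j; decide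
    exact h
  · exact (x.2.1 i j hij : x.1.2.1 i j = 0) ▸ U.zero_mem

/-- Two of the three edge labels are coordinates. The third, on the face `f_2`, is `∂^*w₂ + w₁' -
w₁`, which lies in `U` once `w₂ = 0` and the other two do. -/
theorem mem_labelSubspace_two (U : Submodule ℝ W₁) (x : D.V _⦋2⦌) :
    x ∈ (D.labelSubspace U).obj 2 ↔
      (D.coord₂ x).1 = 0 ∧ (D.coord₂ x).2.1 ∈ U ∧ (D.coord₂ x).2.2.1 ∈ U := by
  refine ⟨fun h => ⟨h.2 0 1 2, h.1 1 2, h.1 0 2⟩, fun ⟨h0, h1, h2⟩ =>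
    ⟨fun (i : Fin 3) (j : Fin 3) => ?_, fun (i : Fin 3) (j : Fin 3) (k : Fin 3) => ?_⟩⟩
  · by_cases hij : i < j
    · have : (i = 0 ∧ j = 1) ∨ (i = 0 ∧ j = 2) ∨ (i = 1 ∧ j = 2) := by revert i j; decide
      rcases this with ⟨rfl, rfl⟩ | ⟨rfl, rfl⟩ | ⟨rfl, rfl⟩
      · have e : x.1.2.1 0 1 = D.bdryStar (D.coord₂ x).1 + (D.coord₂ x).2.2.1 - (D.coord₂ x).2.1 :=
          congrArg Prod.fst (D.coord₁_face_two x)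
        rw [h0, map_zero, zero_add] at e
        exact e ▸ U.sub_mem h2 h1
      · exact h2
      · exact h1
    · exact (x.2.1 i j hij : x.1.2.1 i j = 0) ▸ U.zero_mem
  · by_cases hijk : i < j ∧ j < k
    · obtain ⟨rfl, rfl, rfl⟩ : i = 0 ∧ j = 1 ∧ k = 2 := by revert i j k; decide
      exact h0
    · exact x.2.2.1 i j k hijk

theorem isWide_labelSubspace (U : Submodule ℝ W₁) : (D.labelSubspace U).IsWide := by
  refine (Submodule.eq_top_iff').2 fun x =>
    ⟨fun (i : Fin 1) (j : Fin 1) => ?_, fun (i : Fin 1) (j : Fin 1) (k : Fin 1) =>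
      x.2.2.1 i j k (by revert i j k; decide)⟩
  exact (x.2.1 i j (by revert i j; decide) : x.1.2.1 i j = 0) ▸ U.zero_mem

/-- Once the `W₀^*` components vanish, the form only pairs the `f_0` label of one triangle with the
`f_1` label of the other, so isotropy of `U` gives one inclusion. For the other, `x` is tested
against triangles supported in a single coordinate. -/
theorem isLagrangian_labelSubspace {U : Submodule ℝ W₁} (hU : D.IsSelfOrthogonal U) :
    (D.labelSubspace U).IsLagrangian D.form := by
  have hsym : ∀ u w, D.pairing u w = D.pairing w u := fun u w => D.symm.eq u w
  intro x
  constructor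
  · intro hx y hy
    rw [mem_labelSubspace_two] at hx hy
    rw [form_apply, hx.1, hy.1, (hU _).1 hy.2.2 _ hx.2.1, (hU _).1 hy.2.1 _ hx.2.2]
    simp
  · intro h
    have key : ∀ w ∈ U, ∀ w' ∈ U, ∀ w₀, D.form x (D.coord₂.symm (0, w, w', w₀)) = 0 := by
      intro w hw w' hw' w₀
      refine h _ ((D.mem_labelSubspace_two U _).2 ?_)
      simp [hw, hw']
    -- The test triangle `(0, 0, 0, w₀)` evaluates the `W₀^*` component of `x` at `w₀`, up to sign.
    have h0 : (D.coord₂ x).1 = 0 := by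
      ext w₀
      simpa [form_apply] using key 0 U.zero_mem 0 U.zero_mem w₀
    refine (D.mem_labelSubspace_two U x).2 ⟨h0, (hU _).2 fun u hu => ?_, (hU _).2 fun u hu => ?_⟩
    -- Because the form crosses the two slots, the `f_0` label of `x` is tested by `(0, 0, u, 0)`,
    -- and the `f_1` label below by `(0, u, 0, 0)`.
    · rw [hsym]
      simpa [form_apply, h0] using key 0 U.zero_mem u hu 0
    · rw [hsym]
      simpa [form_apply, h0] using key u hu 0 U.zero_mem 0

/-! ### From wide Lagrangian sub-2-groupoids to self-orthogonal subspaces. -/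

variable {D} (L : SimplicialSubspace D.V)

/-- The subspace of labels of edges of `L` that end at the origin. -/
noncomputable def edgeLabels : Submodule ℝ W₁ :=
  (L.obj 1).comap (D.coord₁.symm.toLinearMap ∘ₗ LinearMap.inl ℝ W₁ W₀)

theorem mem_edgeLabels (w : W₁) : w ∈ edgeLabels L ↔ D.coord₁.symm (w, 0) ∈ L.obj 1 := Iff.rfl

theorem edgeLabels_labelSubspace (U : Submodule ℝ W₁) :
    edgeLabels (D.labelSubspace U) = U := by
  ext w
  rw [mem_edgeLabels, mem_labelSubspace_one]
  simp

variable {L}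

theorem mem_obj_zero (hw : L.IsWide) (x : D.V _⦋0⦌) : x ∈ L.obj 0 := by
  have h : L.obj 0 = ⊤ := hw
  rw [h]
  trivial

/-- Width places every degenerate edge in `L`, so subtracting the one at the last vertex moves that
vertex to the origin without affecting membership. -/
theorem mem_obj_one_iff (hw : L.IsWide) (x : D.V _⦋1⦌) :
    x ∈ L.obj 1 ↔ (D.coord₁ x).1 ∈ edgeLabels L := by
  have h : D.V.degen 0 (D.coord₀.symm (D.coord₁ x).2) ∈ L.obj 1 :=
    L.degen_mem 0 (mem_obj_zero hw _)
  have e : x = D.coord₁.symm ((D.coord₁ x).1, 0) +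
      D.V.degen 0 (D.coord₀.symm (D.coord₁ x).2) := by
    apply D.coord₁.injective
    rw [map_add, coord₁_degen]
    simp
  have h' := (L.obj 1).add_mem_iff_left (x := D.coord₁.symm ((D.coord₁ x).1, 0)) h
  rwa [← e] at h'

/-- The doubly degenerate triangle on a point `w₀` lies in `L_2` by width, and its pairing with `x`
is the `W₀^*` component of `x` evaluated at `w₀` (`pairingA_form`). -/
theorem coord₂_fst_eq_zero (hl : L.IsLagrangian D.form) (hw : L.IsWide) {x : D.V _⦋2⦌}
    (hx : x ∈ L.obj 2) : (D.coord₂ x).1 = 0 := by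
  ext w₀
  have h := (hl _).1 (L.degen_mem 0 (L.degen_mem 0 (mem_obj_zero hw (D.coord₀.symm w₀)))) x hx
  have := D.pairingA_form (D.coord₀.symm w₀) x
  rw [LinearEquiv.apply_symm_apply] at this
  exact this.symm.trans h

/-- This is where `L_1` determines `L_2`: faces give one direction, and degeneracies of edges give
the other. -/
theorem mem_obj_two_iff (hl : L.IsLagrangian D.form) (hw : L.IsWide) (x : D.V _⦋2⦌) :
    x ∈ L.obj 2 ↔ (D.coord₂ x).1 = 0 ∧
      (D.coord₂ x).2.1 ∈ edgeLabels L ∧ (D.coord₂ x).2.2.1 ∈ edgeLabels L := by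
  constructor
  · intro hx
    exact ⟨coord₂_fst_eq_zero hl hw hx, (mem_obj_one_iff hw _).1 (L.face_mem 0 hx),
      (mem_obj_one_iff hw _).1 (L.face_mem 1 hx)⟩
  · rintro ⟨h0, h1, h2⟩
    -- In coordinates, `(0, w₁, w₁', w₀) = (0, w₁, w₁, 0) + (0, 0, w₁' - w₁, w₀)`, a value of `σ_0`
    -- plus a value of `σ_1`.
    have e : x = D.V.degen 0 (D.coord₁.symm ((D.coord₂ x).2.1, 0)) +
        D.V.degen 1
          (D.coord₁.symm ((D.coord₂ x).2.2.1 - (D.coord₂ x).2.1, (D.coord₂ x).2.2.2)) := by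
      apply D.coord₂.injective
      rw [map_add, coord₂_degen_zero, coord₂_degen_one]
      refine Prod.ext ?_ ?_
      · simp [h0]
      · simp
    rw [e]
    refine (L.obj 2).add_mem (L.degen_mem 0 h1) (L.degen_mem 1 ((mem_obj_one_iff hw _).2 ?_))
    simpa using (edgeLabels L).sub_mem h2 h1

/-- The triangles `(0, 0, u, 0)` and `(0, w, 0, 0)` pair to `½⟨u, w⟩`, so the two halves of the
Lagrangian condition translate into the two inclusions between `U` and `U^⊥`. -/
theorem isSelfOrthogonal_edgeLabels (hl : L.IsLagrangian D.form) (hw : L.IsWide) :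
    D.IsSelfOrthogonal (edgeLabels L) := by
  have mem : ∀ w w', D.coord₂.symm (0, w, w', 0) ∈ L.obj 2 ↔
      w ∈ edgeLabels L ∧ w' ∈ edgeLabels L := by
    intro w w'
    rw [mem_obj_two_iff hl hw]
    simp
  intro w
  constructor
  · intro h u hu
    have := (hl _).1 ((mem 0 u).2 ⟨zero_mem _, hu⟩) _ ((mem w 0).2 ⟨h, zero_mem _⟩)
    simpa [form_apply] using this
  · intro h
    -- Against any `y` in `L_2`, the triangle `(0, 0, w, 0)` sees only the `f_0` label of `y`, which
    -- is an edge label of `L`. Maximality of `L_2` then puts this triangle in `L_2`.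
    refine ((mem 0 w).1 ((hl _).2 fun y hy => ?_)).2
    obtain ⟨h0, h1, -⟩ := (mem_obj_two_iff hl hw y).1 hy
    have s := D.symm.eq (D.coord₂ y).2.1 w
    have := h _ h1
    simp [form_apply, h0] at s ⊢
    rw [← s, this]

/-- The coordinate descriptions settle dimensions 0, 1 and 2. Above that, membership in either
sub-2-groupoid can be checked on faces, so agreement propagates upward. -/
theorem labelSubspace_edgeLabels [FiniteDimensional ℝ W₀] (hL : L.IsSubTwoGroupoid)
    (hl : L.IsLagrangian D.form) (hw : L.IsWide) : D.labelSubspace (edgeLabels L) = L := by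
  have hV : D.V.IsTwoGroupoid := D.symplecticTwoGroupoid.isTwoGroupoid
  have h2 : ∀ x, x ∈ (D.labelSubspace (edgeLabels L)).obj 2 ↔ x ∈ L.obj 2 := fun x => by
    rw [mem_labelSubspace_two, mem_obj_two_iff hl hw]
  -- The induction starts in dimension 2, since `mem_of_forall_face_mem` applies only from dimension
  -- 3 on.
  have h : ∀ n x, x ∈ (D.labelSubspace (edgeLabels L)).obj (n + 2) ↔ x ∈ L.obj (n + 2) := by
    intro n
    induction n with
    | zero => exact h2
    | succ n ih =>
      intro x
      exact ⟨fun hx => L.mem_of_forall_face_mem hV hL fun i =>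
          (ih _).1 ((D.labelSubspace (edgeLabels L)).face_mem i hx),
        fun hx => (D.labelSubspace (edgeLabels L)).mem_of_forall_face_mem hV
          (SimplicialSubspace.isSubTwoGroupoid _ hV) fun i => (ih _).2 (L.face_mem i hx)⟩
  refine SimplicialSubspace.ext (funext fun n => Submodule.ext fun x => ?_)
  match n, x with
  | 0, x => exact iff_of_true (mem_obj_zero (D.isWide_labelSubspace _) x) (mem_obj_zero hw x)
  | 1, x => rw [mem_labelSubspace_one, mem_obj_one_iff hw]
  | n + 2, x => exact h n x

end Groupoid

/-! ### Constant Dirac structures and the correspondence. -/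

variable {W₀ : Type u} {W₁ : Type v} [NormedAddCommGroup W₀] [NormedSpace ℝ W₀]
  [NormedAddCommGroup W₁] [NormedSpace ℝ W₁] [FiniteDimensional ℝ W₀] [FiniteDimensional ℝ W₁]
  (D : CourantData W₀ W₁)

/-- For a constant Courant algebroid, involutivity of a self-orthogonal constant subbundle is
automatic. -/
theorem isConstantDirac_iff (U : Submodule ℝ W₁) :
    D.courantAlgebroid.IsConstantDirac U ↔ D.IsSelfOrthogonal U := by
  -- The fibre is the same everywhere, so orthogonality at the single base point `0` suffices.
  refine ⟨fun h => h.orthogonal 0, fun hU => ⟨isSmoothSubbundle_const U, fun _ => hU, ?_⟩⟩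
  intro e₁ e₂ h₁ h₂ x
  have m₁ := fderiv_mem_of_forall_mem (differentiable_section e₁) h₁ x
  have m₂ := fderiv_mem_of_forall_mem (differentiable_section e₂) h₂ x
  -- Paired with `u`, this term is `⟨∇_{∂u} e₁, e₂⟩`, a pairing of two elements of `U`, hence zero.
  have hs : D.starPairing (fderiv ℝ e₁.1 x) (e₂.1 x) = 0 := by
    apply D.ext_pairing
    intro u
    rw [pairing_starPairing, (hU _).1 (h₂ x) _ (m₁ _), map_zero, LinearMap.zero_apply]
  change D.bracketFun e₁.1 e₂.1 x ∈ U
  rw [bracketFun, hs, add_zero]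
  exact U.sub_mem (m₂ _) (m₁ _)

/-- Constant Dirac structures correspond to wide linear Lagrangian sub-2-groupoids. -/
noncomputable def diracEquiv : {U : Submodule ℝ W₁ // D.courantAlgebroid.IsConstantDirac U} ≃
    {L : SimplicialSubspace D.V // L.IsSubTwoGroupoid ∧ L.IsLagrangian D.form ∧ L.IsWide} where
  toFun U := ⟨D.labelSubspace U.1,
    SimplicialSubspace.isSubTwoGroupoid _ D.symplecticTwoGroupoid.isTwoGroupoid,
    D.isLagrangian_labelSubspace ((D.isConstantDirac_iff _).1 U.2), D.isWide_labelSubspace _⟩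
  invFun L := ⟨edgeLabels L.1,
    (D.isConstantDirac_iff _).2 (isSelfOrthogonal_edgeLabels L.2.2.1 L.2.2.2)⟩
  left_inv U := Subtype.ext (edgeLabels_labelSubspace U.1)
  right_inv L := Subtype.ext (labelSubspace_edgeLabels L.2.1 L.2.2.1 L.2.2.2)

end CourantData

theorem theorem5p6 {W₀ : Type u} {W₁ : Type v}
    [NormedAddCommGroup W₀] [NormedSpace ℝ W₀] [FiniteDimensional ℝ W₀]
    [NormedAddCommGroup W₁] [NormedSpace ℝ W₁] [FiniteDimensional ℝ W₁]
    (D : CourantData W₀ W₁) :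
    ∃ Φ : {U : Submodule ℝ W₁ // D.courantAlgebroid.IsConstantDirac U} ≃
        {L : SimplicialSubspace D.symplecticTwoGroupoid.V //
          L.IsSubTwoGroupoid ∧ L.IsLagrangian D.symplecticTwoGroupoid.ω ∧ L.IsWide},
      ∀ U : {U : Submodule ℝ W₁ // D.courantAlgebroid.IsConstantDirac U},
        (∀ x : D.V _⦋1⦌, x ∈ (Φ U).1.obj 1 ↔ (D.coord₁ x).1 ∈ U.1) ∧
        (∀ x : D.V _⦋2⦌, x ∈ (Φ U).1.obj 2 ↔
          (D.coord₂ x).1 = 0 ∧ (D.coord₂ x).2.1 ∈ U.1 ∧ (D.coord₂ x).2.2.1 ∈ U.1) := by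
  -- The forward map of `diracEquiv` is `labelSubspace` by definition, so its coordinate
  -- descriptions apply directly.
  exact ⟨D.diracEquiv, fun U => ⟨D.mem_labelSubspace_one U.1, D.mem_labelSubspace_two U.1⟩⟩
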